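/- Let $K$ be a perfect field, let $P=K[X_0,\dots,X_n]$ with its standard grading, let $I\subseteq P$ be a saturated homogeneous ideal, let $R=P/I$ be the graded residue class ring, and let $\mathbb{X}=\operatorname{Proj}(R)\subseteq\mathbb{P}^n_K$ be the closed subscheme defined by $I$. Assume that $\dim \mathbb{X}=0$ and that no point of $\mathbb{X}$ lies on the hyperplane $X_0=0$. Write $x_0$ for the image of $X_0$ in $R$, and let $S=R/\langle x_0-1\rangle$ be the affine coordinate ring of $\mathbb{X}$. For $m\ge 0$ let $\Omega^m_{R/K}=\Lambda^m_R\,\Omega^1_{R/K}$ with its natural grading, in which $f\,dg_1\wedge\cdots\wedge dg_m$ with homogeneous $f,g_1,\dots,g_m\in R$ has degree $\deg f+\deg g_1+\cdots+\deg g_m$. Then the Hilbert functions $i\mapsto\dim_K R_i$ and $i\mapsto \dim_K(\Omega^m_{R/K})_i$ (for every $m\ge 0$) are constant for $i\gg 0$. Denote these constant values by $\deg\mathbb{X}$ and $\operatorname{HP}(\Omega^m_{R/K})$, respectively. The following conditions are equivalent: (a) The scheme $\mathbb{X}$ is smooth over $K$. (b) $\Omega^1_{S/K}=0$. (c) $\operatorname{HP}(\Omega^1_{R/K})=\deg\mathbb{X}$,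 and $\operatorname{HP}(\Omega^m_{R/K})=0$ for all $m\ge 2$. -/

import Mathlib

open CategoryTheory AlgebraicGeometry
open scoped DirectSum KaehlerDifferential

noncomputable section

namespace ZeroDimScheme

universe u

section QuotientGrading

variable {K A : Type u} [CommRing K] [CommRing A] [Algebra K A]
  (𝒜 : ℕ → Submodule K A) [GradedAlgebra 𝒜] (I : HomogeneousIdeal 𝒜)

/-- The degree `i` part of the quotient of a graded algebra by a homogeneous ideal: the image of
the degree `i` part. -/
def quotientGrading (i : ℕ) : Submodule K (A ⧸ I.toIdeal) :=
  (𝒜 i).map (Ideal.Quotient.mkₐ K I.toIdeal).toLinearMap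

theorem mk_mem_quotientGrading {i : ℕ} {a : A} (ha : a ∈ 𝒜 i) :
    Ideal.Quotient.mk I.toIdeal a ∈ quotientGrading 𝒜 I i :=
  ⟨a, ha, rfl⟩

/-- The residue class map in degree `i`. -/
def quotientGradingMk (i : ℕ) : 𝒜 i →+ quotientGrading 𝒜 I i where
  toFun a := ⟨Ideal.Quotient.mk I.toIdeal a, mk_mem_quotientGrading 𝒜 I a.2⟩
  map_zero' := by ext; simp
  map_add' a b := by ext; simp

/-- The map sending a residue class to the residue classes of the homogeneous components of a
representative. -/
def quotientDecompose : A ⧸ I.toIdeal →+ ⨁ i, quotientGrading 𝒜 I i :=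
  QuotientAddGroup.lift (Submodule.toAddSubgroup I.toIdeal)
    ((DirectSum.map (quotientGradingMk 𝒜 I)).comp
      (DirectSum.decomposeAddEquiv 𝒜).toAddMonoidHom) (by
    intro a ha
    ext i
    simp only [AddMonoidHom.comp_apply, DirectSum.map_apply]
    exact Ideal.Quotient.eq_zero_iff_mem.mpr (I.isHomogeneous i ha))

theorem quotientDecompose_mk (a : A) :
    quotientDecompose 𝒜 I (Ideal.Quotient.mk I.toIdeal a) =
      DirectSum.map (quotientGradingMk 𝒜 I) (DirectSum.decompose 𝒜 a) := rfl

instance quotientGrading.gradedAlgebra : GradedAlgebra (quotientGrading 𝒜 I) where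
  one_mem := mk_mem_quotientGrading 𝒜 I SetLike.GradedOne.one_mem
  mul_mem := by
    rintro i j _ _ ⟨a, ha, rfl⟩ ⟨b, hb, rfl⟩
    exact ⟨a * b, SetLike.GradedMul.mul_mem ha hb, map_mul (Ideal.Quotient.mk I.toIdeal) a b⟩
  toDecomposition := DirectSum.Decomposition.ofAddHom (quotientGrading 𝒜 I)
    (quotientDecompose 𝒜 I)
    (by
      ext x
      obtain ⟨a, rfl⟩ := Ideal.Quotient.mk_surjective x
      simp only [AddMonoidHom.comp_apply, AddMonoidHom.id_apply, quotientDecompose_mk]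
      induction a using DirectSum.Decomposition.inductionOn 𝒜 with
      | zero => simp
      | @homogeneous i a =>
        rw [DirectSum.decompose_coe, DirectSum.map_of, DirectSum.coeAddMonoidHom_of]
        rfl
      | add a b ha hb => rw [DirectSum.decompose_add, map_add, map_add, ha, hb, map_add])
    (by
      ext i ⟨_, a, ha, rfl⟩ : 2
      simp only [AddMonoidHom.comp_apply, AddMonoidHom.id_apply, DirectSum.coeAddMonoidHom_of]
      refine (quotientDecompose_mk 𝒜 I a).trans ?_
      rw [DirectSum.decompose_of_mem 𝒜 ha, DirectSum.map_of]
      rfl)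

end QuotientGrading

section Scheme

variable (K : Type u) [Field K]

/-- `Proj` of a graded `K`-algebra as a scheme over `K`: the structure morphism. -/
def projToSpec {A : Type u} [CommRing A] [Algebra K A] (𝒜 : ℕ → Submodule K A)
    [GradedAlgebra 𝒜] : Proj 𝒜 ⟶ Spec (CommRingCat.of K) :=
  Proj.toSpecZero 𝒜 ≫ Spec.map (CommRingCat.ofHom (algebraMap K (𝒜 0)))

/-- The standard grading of `P = K[X₀, …, Xₙ]`. -/
abbrev stdGrading (n : ℕ) : ℕ → Submodule K (MvPolynomial (Fin (n + 1)) K) :=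
  MvPolynomial.homogeneousSubmodule (Fin (n + 1)) K

instance stdGrading.gradedAlgebra (n : ℕ) : GradedAlgebra (stdGrading K n) :=
  MvPolynomial.gradedAlgebra

variable {K} {n : ℕ} (I : HomogeneousIdeal (stdGrading K n))

/-- `I` is saturated with respect to `𝔪 = ⟨X₀, …, Xₙ⟩`: if `𝔪 ^ k * f ⊆ I` for some `k`,
then `f ∈ I`. -/
def IsSaturated : Prop :=
  ∀ (f : MvPolynomial (Fin (n + 1)) K) (k : ℕ),
    (∀ g ∈ (HomogeneousIdeal.irrelevant (stdGrading K n)).toIdeal ^ k, g * f ∈ I.toIdeal) →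
      f ∈ I.toIdeal

/-- The homogeneous coordinate ring `R = P / I`. -/
abbrev CoordRing : Type u := MvPolynomial (Fin (n + 1)) K ⧸ I.toIdeal

/-- The grading of `R = P / I`. -/
abbrev coordGrading : ℕ → Submodule K (CoordRing I) := quotientGrading (stdGrading K n) I

/-- The image `x₀` of `X₀` in `R`. -/
abbrev x₀ : CoordRing I := Ideal.Quotient.mk I.toIdeal (MvPolynomial.X 0)

/-- The affine coordinate ring `S = R / ⟨x₀ - 1⟩`. -/
abbrev AffineCoordRing : Type u := CoordRing I ⧸ Ideal.span {x₀ I - 1}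

/-- The closed subscheme of `ℙⁿ` defined by `I`. -/
abbrev subscheme : Scheme.{u} := Proj (coordGrading I)

/-- The subscheme of `ℙⁿ` defined by `I` is smooth over `K`. -/
def IsSmoothSubscheme : Prop := Smooth (projToSpec K (coordGrading I))

end Scheme

section Hilbert

variable {K A : Type u} [Field K] [CommRing A] [Algebra K A] (𝒜 : ℕ → Submodule K A)

/-- The degree `i` part of `Ω^m_{A/K} = Λ^m_A Ω^1_{A/K}` for a graded `K`-algebra `A`: the
`K`-span of the forms `f dg₁ ∧ ⋯ ∧ dgₘ` with `f, g₁, …, gₘ` homogeneous of total degree `i`. -/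
def formsDegree (m i : ℕ) : Submodule K (⋀[A]^m Ω[A⁄K]) :=
  Submodule.span K {w | ∃ (a : ℕ) (b : Fin m → ℕ) (f : A) (g : Fin m → A),
    f ∈ 𝒜 a ∧ (∀ j, g j ∈ 𝒜 (b j)) ∧ a + ∑ j, b j = i ∧
      w = f • exteriorPower.ιMulti A m (fun j => KaehlerDifferential.D K A (g j))}

/-- The Hilbert function of a graded `K`-algebra. -/
def hilbertFun (i : ℕ) : ℕ := Module.finrank K (𝒜 i)

/-- The Hilbert function of `Ω^m_{A/K}` (it vanishes in negative degrees). -/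
def hilbertFunForms (m i : ℕ) : ℕ := Module.finrank K (formsDegree 𝒜 m i)

/-- `c` is the eventual value of `H`. -/
def IsEventualValue (H : ℕ → ℕ) (c : ℕ) : Prop := ∀ᶠ i in Filter.atTop, H i = c

/-- The constant Hilbert polynomial belonging to a Hilbert function `H`: the number `c` with
`H i = c` for `i ≫ 0` (and `0` if `H` is not eventually constant). -/
def hilbertPoly (H : ℕ → ℕ) : ℕ :=
  open Classical in if h : ∃ c, IsEventualValue H c then h.choose else 0

theorem IsEventualValue.hilbertPoly_eq {H : ℕ → ℕ} {c : ℕ} (h : IsEventualValue H c) :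
    hilbertPoly H = c := by
  have hex : ∃ c, IsEventualValue H c := ⟨c, h⟩
  obtain ⟨i, h₁, h₂⟩ := (hex.choose_spec.and h).exists
  rw [hilbertPoly, dif_pos hex, ← h₁, ← h₂]

end Hilbert

end ZeroDimScheme

end

open ZeroDimScheme

/-! Since no point lies on `x₀ = 0`, every variable is nilpotent modulo `x₀`, so `R_{i+1} = x₀ R_i`
in large degrees. The dimensions then decrease, hence stabilise, after which multiplication by `x₀`
is injective; this gives `R_i ≅ S` for `i ≫ 0` (`bijective_mk_of_injective`). Each `Ω^m` is spanned
over `R` by finitely many wedges of the `dX_j`, so it stabilises in the same way.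

The key is `bijective_map_prod_eulerContraction`: for `i ≫ 0`, `(Ω^1_R)_i ≅ Ω^1_S × S`. The first
component restricts to `x₀ = 1`; the second contracts with the Euler derivation and recovers the
`dx₀` part. Hence `HP(Ω^1_R) = dim Ω^1_S + deg X`, and the first equality in (c) says exactly that
`Ω^1_S = 0`. Conversely, if `Ω^1_S = 0`, all differentials become multiples of `dx₀` once `x₀` is
inverted, so wedges of two or more of them are killed by a power of `x₀` and vanish in large
degrees.

Finally `Proj R` is `Spec S` with `S` finite over `K`, and a finite algebra over a field is smooth
iff it is unramified: a smooth one is locally étale over a polynomial ring, which embeds in a finite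
dimensional algebra and so has no variables. -/

/-! ### Finite algebras over a field: smooth means unramified. -/

theorem MvPolynomial.isEmpty_of_finite {K σ : Type*} [Field K]
    [Module.Finite K (MvPolynomial σ K)] : IsEmpty σ := by
  by_contra h
  rw [not_isEmpty_iff] at h
  obtain ⟨i⟩ := h
  have hint : IsIntegral K (MvPolynomial.X i : MvPolynomial σ K) := Algebra.IsIntegral.isIntegral _
  exact MvPolynomial.transcendental_X K i hint.isAlgebraic

/-- A finite smooth algebra over a field is unramified. -/
theorem Algebra.FormallyUnramified.of_smooth_of_finite {K S : Type*} [Field K] [CommRing S]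
    [Algebra K S] [Module.Finite K S] [Algebra.Smooth K S] : Algebra.FormallyUnramified K S := by
  rw [← Algebra.unramifiedLocus_eq_univ_iff, Set.eq_univ_iff_forall]
  intro p
  have : Algebra.IsSmoothAt K p.asIdeal := by
    have h := Algebra.smoothLocus_eq_univ (R := K) (A := S)
    exact (h ▸ Set.mem_univ p : p ∈ Algebra.smoothLocus K S)
  obtain ⟨f, hf, n, _, _, _⟩ :=
    Algebra.IsSmoothAt.exists_isStandardEtale_mvPolynomial (R := K) (p := p.asIdeal)
  -- Localization maps of Artinian rings are surjective, so the neighbourhood stays finite over `K`.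
  have : IsArtinianRing S := IsArtinianRing.of_finite K S
  have : Module.Finite K (Localization.Away f) :=
    Module.Finite.of_surjective (Algebra.linearMap S (Localization.Away f) |>.restrictScalars K)
      (IsArtinianRing.localization_surjective (Submonoid.powers f) (Localization.Away f))
  have : Nontrivial (Localization.Away f) := by
    refine ⟨0, 1, fun h => hf ?_⟩
    rw [eq_comm, ← map_one (algebraMap S _),
      IsLocalization.map_eq_zero_iff (Submonoid.powers f)] at h
    obtain ⟨⟨_, N, rfl⟩, h⟩ := h
    exact p.2.mem_of_pow_mem N (by simp_all)
  -- A nonzero flat algebra over a domain contains it, so the polynomial ring is finite over `K` and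
  -- `n = 0`.
  have : FaithfulSMul (MvPolynomial (Fin n) K) (Localization.Away f) := by
    rw [faithfulSMul_iff_algebraMap_injective]
    have := Algebra.Smooth.flat (MvPolynomial (Fin n) K) (Localization.Away f)
    exact FaithfulSMul.algebraMap_injective _ _
  have : Module.Finite K (MvPolynomial (Fin n) K) :=
    Module.Finite.of_injective
      (Algebra.linearMap (MvPolynomial (Fin n) K) (Localization.Away f) |>.restrictScalars K)
      (FaithfulSMul.algebraMap_injective _ _)
  have := MvPolynomial.isEmpty_of_finite (K := K) (σ := Fin n)
  have : Algebra.FormallyUnramified K (MvPolynomial (Fin n) K) :=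
    .of_equiv (MvPolynomial.isEmptyAlgEquiv K (Fin n)).symm
  have : Algebra.FormallyUnramified K (Localization.Away f) :=
    .comp K (MvPolynomial (Fin n) K) _
  exact Algebra.basicOpen_subset_unramifiedLocus_iff.mpr this hf

/-- For the converse, an unramified algebra of finite type over a field is already étale. -/
theorem Algebra.smooth_iff_subsingleton_kaehlerDifferential {K S : Type*} [Field K] [CommRing S]
    [Algebra K S] [Module.Finite K S] : Algebra.Smooth K S ↔ Subsingleton Ω[S⁄K] := by
  constructor
  · intro _
    exact (Algebra.FormallyUnramified.of_smooth_of_finite).subsingleton_kaehlerDifferential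
  · intro h
    have : Algebra.FormallyUnramified K S := ⟨h⟩
    have : Algebra.FormallyEtale K S := .of_formallyUnramified_of_field K S
    have : IsArtinianRing S := IsArtinianRing.of_finite K S
    exact ⟨inferInstance, (Algebra.FinitePresentation.of_finiteType).mp inferInstance⟩

theorem KaehlerDifferential.finite_of_finite (K S : Type*) [Field K] [CommRing S] [Algebra K S]
    [Module.Finite K S] : Module.Finite K Ω[S⁄K] :=
  .trans S _

/-- If `V (i + 1)` is eventually the image of the finite dimensional space `V i` under a fixed
endomorphism `φ`, then the dimension of `V i` is eventually constant, and `φ` is eventually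
injective on `V i`. -/
theorem Submodule.eventually_finrank_eq_of_map_eq {K M : Type*} [Field K] [AddCommGroup M]
    [Module K M] (V : ℕ → Submodule K M) [∀ i, Module.Finite K (V i)] (φ : M →ₗ[K] M) {k : ℕ}
    (h : ∀ i, k ≤ i → V (i + 1) = (V i).map φ) :
    ∃ i₀, ∀ i, i₀ ≤ i → Module.finrank K (V i) = Module.finrank K (V i₀) ∧
      ∀ v ∈ V i, φ v = 0 → v = 0 := by
  have hanti : Antitone fun i => Module.finrank K (V (k + i)) := by
    refine antitone_nat_of_succ_le fun i => ?_
    rw [← add_assoc, h (k + i) (by omega)]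
    exact Submodule.finrank_map_le φ (V (k + i))
  obtain ⟨N, hN⟩ := WellFoundedGT.monotone_chain_condition (α := ℕᵒᵈ)
    ⟨fun i => OrderDual.toDual (Module.finrank K (V (k + i))), fun i j hij => hanti hij⟩
  have hconst : ∀ i, k + N ≤ i → Module.finrank K (V i) = Module.finrank K (V (k + N)) := by
    intro i hi
    have := OrderDual.toDual_inj.mp (hN (i - k) (by omega))
    rw [Nat.add_sub_cancel' (by omega)] at this
    exact this.symm
  refine ⟨k + N, fun i hi => ⟨hconst i hi, fun v hv hφ => ?_⟩⟩
  -- Rank-nullity: `V i` and its image `V (i + 1)` have equal dimension, so the kernel is zero.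
  have hker := LinearMap.finrank_range_add_finrank_ker (φ.domRestrict (V i))
  rw [LinearMap.range_domRestrict, ← h i (by omega), hconst i hi, hconst (i + 1) (by omega)] at hker
  have h0 : LinearMap.ker (φ.domRestrict (V i)) = ⊥ :=
    Submodule.finrank_eq_zero.mp (by omega)
  have hmem : (⟨v, hv⟩ : V i) ∈ LinearMap.ker (φ.domRestrict (V i)) := hφ
  rw [h0, Submodule.mem_bot] at hmem
  exact congrArg Subtype.val hmem

/-! ### Twisting by degree and the Euler derivation. -/

namespace ZeroDimScheme

section Dehomogenization

variable {K A L : Type*} [Field K] [CommRing A] [Algebra K A] (𝒜 : ℕ → Submodule K A)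
  [GradedAlgebra 𝒜]

section Homogenization

variable [CommRing L] [Algebra K L] [Algebra A L] [IsScalarTower K A L] 

/-- For `u : L`, the algebra homomorphism sending a homogeneous element `f` of degree `i` to
`u ^ i * f`. -/
noncomputable def twist (u : L) : A →ₐ[K] L :=
  (DirectSum.toAlgebra K (fun i => 𝒜 i)
    (fun i => LinearMap.mulLeft K (u ^ i) ∘ₗ (Algebra.linearMap A L).restrictScalars K ∘ₗ
      (𝒜 i).subtype)
    (by simp)
    (by intro i j a b; simp [pow_add]; ring)).comp
    (DirectSum.decomposeAlgEquiv 𝒜).toAlgHom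

variable {𝒜}

theorem twist_of_mem (u : L) {i : ℕ} {f : A} (hf : f ∈ 𝒜 i) :
    twist 𝒜 u f = u ^ i * algebraMap A L f := by
  change DirectSum.toAddMonoid (fun i => (LinearMap.mulLeft K (u ^ i) ∘ₗ
    (Algebra.linearMap A L).restrictScalars K ∘ₗ (𝒜 i).subtype).toAddMonoidHom)
    (DirectSum.decompose 𝒜 f) = _
  rw [DirectSum.decompose_of_mem 𝒜 hf, DirectSum.toAddMonoid_of]
  rfl

end Homogenization

/-- The Euler derivation, sending a homogeneous element `f` of degree `i` to `i * f`. -/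
noncomputable def euler : Derivation K A A :=
  Derivation.mk' (DirectSum.toModule K ℕ A (fun i => (i : K) • (𝒜 i).subtype) ∘ₗ
    (DirectSum.decomposeLinearEquiv 𝒜).toLinearMap) (by
    have key : ∀ {i : ℕ} {f : A}, f ∈ 𝒜 i →
        DirectSum.toModule K ℕ A (fun i => (i : K) • (𝒜 i).subtype)
          (DirectSum.decompose 𝒜 f) = (i : K) • f := by
      intro i f hf
      rw [DirectSum.decompose_of_mem 𝒜 hf, ← DirectSum.lof_eq_of K, DirectSum.toModule_lof]
      rfl
    intro a b
    simp only [LinearMap.comp_apply, LinearEquiv.coe_coe, DirectSum.decomposeLinearEquiv_apply]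
    induction a using DirectSum.Decomposition.inductionOn 𝒜 with
    | zero => simp
    | add a a' ha ha' =>
      simp only [add_mul, DirectSum.decompose_add, map_add, smul_add, add_smul] at ha ha' ⊢
      rw [ha, ha']; abel
    | @homogeneous i a =>
      induction b using DirectSum.Decomposition.inductionOn 𝒜 with
      | zero => simp
      | add b b' hb hb' =>
        simp only [mul_add, DirectSum.decompose_add, map_add, smul_add, add_smul] at hb hb' ⊢
        rw [hb, hb']; abel
      | @homogeneous j b =>
        rw [key (SetLike.mul_mem_graded a.2 b.2), key a.2, key b.2]
        simp only [smul_eq_mul, Algebra.smul_def, map_add, Nat.cast_add]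
        ring)

variable {𝒜}

theorem euler_of_mem {i : ℕ} {f : A} (hf : f ∈ 𝒜 i) : euler 𝒜 f = i * f := by
  simp only [euler, Derivation.coe_mk', LinearMap.comp_apply, LinearEquiv.coe_coe,
    DirectSum.decomposeLinearEquiv_apply]
  rw [DirectSum.decompose_of_mem 𝒜 hf, ← DirectSum.lof_eq_of K, DirectSum.toModule_lof]
  simp [Algebra.smul_def]

end Dehomogenization

end ZeroDimScheme

/-! ### Comparing homogeneous components with the dehomogenization. -/

namespace ZeroDimScheme

section Dehomogenization

variable {K A : Type*} [Field K] [CommRing A] [Algebra K A] {𝒜 : ℕ → Submodule K A}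
  [GradedAlgebra 𝒜] {x : A} (hx : x ∈ 𝒜 1)

/-- The dehomogenization `A / (x - 1)` of a ring `A` at `x`. -/
abbrev Dehom (x : A) : Type _ := A ⧸ Ideal.span {x - 1}

include hx in
-- This is what lets the twist by `1 / x` descend to the quotient by `x - 1`.
theorem twist_self :
    twist 𝒜 (IsLocalization.Away.invSelf (S := Localization.Away x) x) x = 1 := by
  rw [twist_of_mem _ hx, pow_one, mul_comm, IsLocalization.Away.mul_invSelf]

/-- The map from the dehomogenization to the localization at `x`, sending the class of a
homogeneous element `f` of degree `i` to `f / x ^ i`. -/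
noncomputable def dehomToAway : Dehom x →ₐ[K] Localization.Away x :=
  Ideal.Quotient.liftₐ _ (twist 𝒜 (IsLocalization.Away.invSelf x)) (by
    intro a ha
    rw [← RingHom.mem_ker]
    refine (Ideal.span_singleton_le_iff_mem _).mpr ?_ ha
    rw [RingHom.mem_ker, map_sub, twist_self hx, map_one, sub_self])

theorem dehomToAway_mk {i : ℕ} {f : A} (hf : f ∈ 𝒜 i) :
    dehomToAway hx (Ideal.Quotient.mk _ f) =
      IsLocalization.Away.invSelf x ^ i * algebraMap A (Localization.Away x) f := by
  rw [← twist_of_mem _ hf]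
  rfl

theorem mk_self : Ideal.Quotient.mk (Ideal.span {x - 1}) x = 1 :=
  (Ideal.Quotient.mk_eq_mk_iff_sub_mem _ _).mpr (Ideal.mem_span_singleton_self _)

/-- A homogeneous element vanishing in the dehomogenization at `x` is killed by a power of `x`. -/
theorem exists_pow_mul_eq_zero_of_mk_eq_zero (hx : x ∈ 𝒜 1) {i : ℕ} {f : A} (hf : f ∈ 𝒜 i)
    (h : Ideal.Quotient.mk (Ideal.span {x - 1}) f = 0) : ∃ N, x ^ N * f = 0 := by
  have h0 := dehomToAway_mk hx hf
  have hu : IsUnit (IsLocalization.Away.invSelf x ^ i : Localization.Away x) :=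
    .pow _ (IsUnit.of_mul_eq_one _
      ((mul_comm _ _).trans (IsLocalization.Away.mul_invSelf x)))
  rw [h, map_zero, eq_comm, hu.mul_right_eq_zero,
    IsLocalization.map_eq_zero_iff (Submonoid.powers x)] at h0
  obtain ⟨⟨_, N, rfl⟩, h0⟩ := h0
  exact ⟨N, h0⟩

/-- If `x` maps `𝒜 i` onto `𝒜 (i + 1)` for `i ≥ k`, then `𝒜 i` maps onto the dehomogenization
for `i ≥ k`. -/
theorem exists_mem_mk_eq (hx : x ∈ 𝒜 1) {k : ℕ}
    (hk : ∀ i, k ≤ i → 𝒜 (i + 1) = (𝒜 i).map (LinearMap.mulLeft K x)) {i : ℕ} (hi : k ≤ i)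
    (s : Dehom x) : ∃ f ∈ 𝒜 i, Ideal.Quotient.mk _ f = s := by
  obtain ⟨f, rfl⟩ := Ideal.Quotient.mk_surjective s
  have up : ∀ j, ∀ f ∈ 𝒜 (i + j), ∃ g ∈ 𝒜 i,
      Ideal.Quotient.mk (Ideal.span {x - 1}) g = Ideal.Quotient.mk _ f := by
    intro j
    induction j with
    | zero => exact fun f hf => ⟨f, hf, rfl⟩
    | succ j ih =>
      intro f hf
      rw [← add_assoc, hk _ (by omega)] at hf
      obtain ⟨g, hg, rfl⟩ := hf
      obtain ⟨g', hg', h⟩ := ih g hg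
      exact ⟨g', hg', by rw [h, LinearMap.mulLeft_apply, map_mul, mk_self, one_mul]⟩
  induction f using DirectSum.Decomposition.inductionOn 𝒜 with
  | zero => exact ⟨0, zero_mem _, rfl⟩
  | add a b ha hb =>
    obtain ⟨f, hf, ha⟩ := ha
    obtain ⟨g, hg, hb⟩ := hb
    exact ⟨f + g, add_mem hf hg, by rw [map_add, map_add, ha, hb]⟩
  | @homogeneous j a =>
    -- The class of `x` is `1`, so powers of `x` may be divided out from above or multiplied in from
    -- below to reach degree `i`.
    rcases le_total i j with hij | hij
    · obtain ⟨j, rfl⟩ := Nat.exists_eq_add_of_le hij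
      exact up j a a.2
    · refine ⟨x ^ (i - j) * a, ?_, by rw [map_mul, map_pow, mk_self, one_pow, one_mul]⟩
      have := SetLike.mul_mem_graded (SetLike.pow_mem_graded (i - j) hx) a.2
      rwa [smul_eq_mul, mul_one, Nat.sub_add_cancel hij] at this

/-- In large degrees, the homogeneous component is isomorphic to the dehomogenization. -/
theorem bijective_mk_of_injective (hx : x ∈ 𝒜 1) {k : ℕ}
    (hk : ∀ i, k ≤ i → 𝒜 (i + 1) = (𝒜 i).map (LinearMap.mulLeft K x))
    (hinj : ∀ i, k ≤ i → ∀ f ∈ 𝒜 i, x * f = 0 → f = 0) {i : ℕ} (hi : k ≤ i) :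
    Function.Bijective
      ((Ideal.Quotient.mkₐ K (Ideal.span {x - 1})).toLinearMap.domRestrict (𝒜 i)) := by
  constructor
  · rw [← LinearMap.ker_eq_bot, LinearMap.ker_eq_bot']
    rintro ⟨f, hf⟩ h
    obtain ⟨N, hN⟩ := exists_pow_mul_eq_zero_of_mk_eq_zero hx hf h
    have key : ∀ N, x ^ N * f = 0 → f = 0 := by
      intro N
      induction N with
      | zero => simp
      | succ N ih =>
        intro h
        refine ih (hinj (N + i) (by omega) _ ?_ (by rw [← h]; ring))
        simpa using SetLike.mul_mem_graded (SetLike.pow_mem_graded N hx) hf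
    exact Subtype.ext (key N hN)
  · intro s
    obtain ⟨f, hf, rfl⟩ := exists_mem_mk_eq hx hk hi s
    exact ⟨⟨f, hf⟩, rfl⟩

end Dehomogenization

end ZeroDimScheme

/-- Here `du = -u² dx`, so `b u^(b-1) du` turns into a multiple of `u^(b+1)` and no truncated
exponent appears. -/
theorem KaehlerDifferential.D_pow_of_mul_eq_one {K L : Type*} [CommRing K] [CommRing L]
    [Algebra K L] {x u : L} (h : x * u = 1) (b : ℕ) :
    D K L (u ^ b) = -((b : L) * u ^ (b + 1)) • D K L x := by
  have hu : D K L u = -(u ^ 2) • D K L x := by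
    have h1 := congrArg (fun z => u • D K L z) h
    simp only [Derivation.leibniz, Derivation.map_one_eq_zero, smul_zero, smul_add, smul_smul] at h1
    rw [mul_comm u x, h, one_smul] at h1
    rw [neg_smul, pow_two]
    exact eq_neg_of_add_eq_zero_left h1
  induction b with
  | zero => simp
  | succ b ih =>
    rw [pow_succ, Derivation.leibniz, ih, hu, smul_smul, smul_smul, ← add_smul]
    congr 1
    push_cast
    ring

/-! ### The graded structure of `Ω^1` in large degrees. -/

namespace ZeroDimScheme

universe u

/-- Passes from vanishing after inverting `x` to vanishing outright; injectivity is only known on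
graded pieces of degree at least `k`, so the powers are peeled off one at a time. -/
theorem eq_zero_of_pow_smul_eq_zero {K A M : Type*} [Semiring K] [Semiring A]
    [AddCommGroup M] [Module K M] [Module A M]
    {V : ℕ → Submodule K M} {x : A} {k : ℕ} (hV : ∀ i, ∀ v ∈ V i, x • v ∈ V (i + 1))
    (hinj : ∀ i, k ≤ i → ∀ v ∈ V i, x • v = 0 → v = 0) {N i : ℕ} (hi : k ≤ i) {v : M}
    (hv : v ∈ V i) (h : x ^ N • v = 0) : v = 0 := by
  induction N generalizing i v with
  | zero => simpa using h
  | succ N ih =>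
    refine hinj i hi v hv (ih (by omega) (hV i v hv) ?_)
    rw [smul_smul, ← pow_succ, h]

section DifferentialsDegree

variable {K A : Type u} [Field K] [CommRing A] [Algebra K A] (𝒜 : ℕ → Submodule K A)

open KaehlerDifferential

/-- The degree `i` part of `Ω[A⁄K]`. -/
noncomputable def differentialsDegree (i : ℕ) : Submodule K Ω[A⁄K] :=
  Submodule.span K {w | ∃ (a b : ℕ) (f g : A), f ∈ 𝒜 a ∧ g ∈ 𝒜 b ∧ a + b = i ∧ w = f • D K A g}

theorem formsDegree_one_map (i : ℕ) :
    (formsDegree 𝒜 1 i).map ((exteriorPower.oneEquiv A Ω[A⁄K]).toLinearMap.restrictScalars K) =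
      differentialsDegree 𝒜 i := by
  rw [formsDegree, Submodule.map_span, differentialsDegree]
  congr 1
  ext w
  constructor
  · rintro ⟨_, ⟨a, b, f, g, hf, hg, h, rfl⟩, rfl⟩
    exact ⟨a, b 0, f, g 0, hf, hg 0, by simpa using h, by simp⟩
  · rintro ⟨a, b, f, g, hf, hg, h, rfl⟩
    exact ⟨_, ⟨a, fun _ => b, f, fun _ => g, hf, fun _ => hg, by simpa using h, rfl⟩, by simp⟩

theorem finrank_formsDegree_one (i : ℕ) :
    Module.finrank K (formsDegree 𝒜 1 i) = Module.finrank K (differentialsDegree 𝒜 i) := by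
  rw [← formsDegree_one_map]
  exact (LinearEquiv.finrank_map_eq
    ((exteriorPower.oneEquiv A Ω[A⁄K]).restrictScalars K) (formsDegree 𝒜 1 i)).symm

variable {𝒜}

theorem smul_mem_differentialsDegree [SetLike.GradedMul 𝒜] {x : A} (hx : x ∈ 𝒜 1) {i : ℕ}
    {w : Ω[A⁄K]} (hw : w ∈ differentialsDegree 𝒜 i) : x • w ∈ differentialsDegree 𝒜 (i + 1) := by
  refine (Submodule.span_le (p := (differentialsDegree 𝒜 (i + 1)).comap
    ((LinearMap.lsmul A Ω[A⁄K] x).restrictScalars K))).mpr ?_ hw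
  rintro _ ⟨a, b, f, g, hf, hg, rfl, rfl⟩
  exact Submodule.subset_span ⟨1 + a, b, x * f, g, SetLike.mul_mem_graded hx hf, hg, by ring,
    by rw [mul_smul]; rfl⟩

theorem smul_mem_formsDegree [SetLike.GradedMul 𝒜] {x : A} (hx : x ∈ 𝒜 1) {m i : ℕ}
    {w : ⋀[A]^m Ω[A⁄K]} (hw : w ∈ formsDegree 𝒜 m i) : x • w ∈ formsDegree 𝒜 m (i + 1) := by
  refine (Submodule.span_le (p := (formsDegree 𝒜 m (i + 1)).comap
    ((LinearMap.lsmul A (⋀[A]^m Ω[A⁄K]) x).restrictScalars K))).mpr ?_ hw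
  rintro _ ⟨a, b, f, g, hf, hg, rfl, rfl⟩
  exact Submodule.subset_span ⟨1 + a, b, x * f, g, SetLike.mul_mem_graded hx hf, hg, by ring,
    by rw [mul_smul]; rfl⟩

end DifferentialsDegree

section Dehomogenization

variable {K A : Type u} [Field K] [CommRing A] [Algebra K A] {𝒜 : ℕ → Submodule K A}
  [GradedAlgebra 𝒜] {x : A} (hx : x ∈ 𝒜 1)

open KaehlerDifferential

/-- The map on differentials induced by `dehomToAway`. -/
noncomputable def dehomToAwayDifferential :
    Ω[Dehom x⁄K] →ₗ[K] Ω[Localization.Away x⁄K] :=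
  letI : Algebra (Dehom x) (Localization.Away x) := (dehomToAway hx).toRingHom.toAlgebra
  haveI : IsScalarTower K (Dehom x) (Localization.Away x) :=
    .of_algebraMap_eq' (dehomToAway hx).comp_algebraMap.symm
  (KaehlerDifferential.map K K (Dehom x) (Localization.Away x)).restrictScalars K

theorem dehomToAwayDifferential_smul_D (s t : Dehom x) :
    dehomToAwayDifferential hx (s • D K (Dehom x) t) =
      dehomToAway hx s • D K (Localization.Away x) (dehomToAway hx t) := by
  let _ : Algebra (Dehom x) (Localization.Away x) := (dehomToAway hx).toRingHom.toAlgebra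
  have : IsScalarTower K (Dehom x) (Localization.Away x) :=
    .of_algebraMap_eq' (dehomToAway hx).comp_algebraMap.symm
  change KaehlerDifferential.map K K (Dehom x) (Localization.Away x) _ = _
  rw [map_smul, KaehlerDifferential.map_D]
  rfl

variable (𝒜) in
/-- The contraction of differentials with the Euler derivation. -/
noncomputable def eulerContraction : Ω[A⁄K] →ₗ[A] A := (euler 𝒜).liftKaehlerDifferential

theorem eulerContraction_smul_D (f : A) {b : ℕ} {g : A} (hg : g ∈ 𝒜 b) :
    eulerContraction 𝒜 (f • D K A g) = b * (f * g) := by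
  rw [eulerContraction, map_smul, Derivation.liftKaehlerDifferential_comp_D, euler_of_mem hg,
    smul_eq_mul]
  ring

theorem eulerContraction_mem {i : ℕ} {w : Ω[A⁄K]} (hw : w ∈ differentialsDegree 𝒜 i) :
    eulerContraction 𝒜 w ∈ 𝒜 i := by
  refine (Submodule.span_le (p := (𝒜 i).comap ((eulerContraction 𝒜).restrictScalars K))).mpr ?_ hw
  rintro _ ⟨a, b, f, g, hf, hg, rfl, rfl⟩
  change eulerContraction 𝒜 (f • D K A g) ∈ 𝒜 (a + b)
  rw [eulerContraction_smul_D f hg, ← nsmul_eq_mul]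
  exact nsmul_mem (SetLike.mul_mem_graded hf hg) b

/-- The image of a homogeneous differential in the localization at `x` is recovered from its image
in the dehomogenization and its contraction with the Euler derivation. -/
theorem pow_smul_map_differential {i : ℕ} {w : Ω[A⁄K]} (hw : w ∈ differentialsDegree 𝒜 i) :
    (IsLocalization.Away.invSelf x : Localization.Away x) ^ i •
        KaehlerDifferential.map K K A (Localization.Away x) w =
      dehomToAwayDifferential hx (KaehlerDifferential.map K K A (Dehom x) w) +
        (IsLocalization.Away.invSelf x ^ (i + 1) *
          algebraMap A (Localization.Away x) (eulerContraction 𝒜 w)) •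
          D K (Localization.Away x) (algebraMap A _ x) := by
  set u : Localization.Away x := IsLocalization.Away.invSelf x with hu
  induction hw using Submodule.span_induction with
  | zero => simp
  | add v w _ _ hv hw =>
    simp only [map_add, smul_add, mul_add, add_smul, hv, hw]
    abel
  | smul c w _ hw =>
    rw [LinearMap.map_smul_of_tower, LinearMap.map_smul_of_tower,
      (eulerContraction 𝒜).map_smul_of_tower c w,
      map_smul, smul_comm, hw, smul_add, Algebra.smul_def c (eulerContraction 𝒜 w), map_mul,
      ← IsScalarTower.algebraMap_apply, ← algebraMap_smul (Localization.Away x) c (_ • _),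
      smul_smul]
    congr 2
    ring
  | mem w hw =>
    obtain ⟨a, b, f, g, hf, hg, rfl, rfl⟩ := hw
    -- By the quotient rule, `d(g / x^b) = dg / x^b - b g x^(-b-1) dx`; the Euler term cancels the
    -- second summand.
    rw [eulerContraction_smul_D f hg, map_smul, map_smul, KaehlerDifferential.map_D,
      KaehlerDifferential.map_D, ← algebraMap_smul (Localization.Away x) f,
      ← algebraMap_smul (Dehom x) f, dehomToAwayDifferential_smul_D,
      Ideal.Quotient.algebraMap_eq, dehomToAway_mk hx hf, dehomToAway_mk hx hg, Derivation.leibniz,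
      KaehlerDifferential.D_pow_of_mul_eq_one (IsLocalization.Away.mul_invSelf x), ← hu,
      smul_add, smul_smul, smul_smul, smul_smul, smul_smul, add_assoc, ← add_smul]
    convert (add_zero _).symm using 2
    · congr 1
      ring
    · rw [← zero_smul (Localization.Away x) (D K (Localization.Away x) (algebraMap A _ x))]
      congr 1
      simp only [map_mul, map_natCast]
      ring

include hx in
/-- In large degrees, the homogeneous component of `Ω[A⁄K]` is isomorphic to the product of the
differentials of the dehomogenization and the dehomogenization itself. -/
theorem bijective_map_prod_eulerContraction {k : ℕ}
    (hk : ∀ i, k ≤ i → 𝒜 (i + 1) = (𝒜 i).map (LinearMap.mulLeft K x))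
    (hinj : ∀ i, k ≤ i → ∀ f ∈ 𝒜 i, x * f = 0 → f = 0)
    (hinj' : ∀ i, k ≤ i → ∀ w ∈ differentialsDegree 𝒜 i, x • w = 0 → w = 0)
    {i : ℕ} (hi : k + k + 1 ≤ i) :
    Function.Bijective (LinearMap.domRestrict
      (((KaehlerDifferential.map K K A (Dehom x)).restrictScalars K).prod
        ((Ideal.Quotient.mkₐ K (Ideal.span {x - 1})).toLinearMap ∘ₗ
          (eulerContraction 𝒜).restrictScalars K)) (differentialsDegree 𝒜 i)) := by
  constructor
  · rw [← LinearMap.ker_eq_bot, LinearMap.ker_eq_bot']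
    rintro ⟨w, hw⟩ h
    obtain ⟨h1, h2⟩ := Prod.ext_iff.mp h
    change KaehlerDifferential.map K K A (Dehom x) w = 0 at h1
    change Ideal.Quotient.mk _ (eulerContraction 𝒜 w) = 0 at h2
    -- The contraction has degree `i ≥ k`, where passing to classes is injective.
    have h3 : eulerContraction 𝒜 w = 0 := by
      have := (bijective_mk_of_injective hx hk hinj (i := i) (by omega)).1
        (a₁ := ⟨_, eulerContraction_mem hw⟩) (a₂ := 0) (by simpa using h2)
      exact congrArg Subtype.val this
    have h4 := pow_smul_map_differential hx hw
    rw [h1, h3, map_zero, map_zero, mul_zero, zero_smul, add_zero] at h4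
    have hu : IsUnit (IsLocalization.Away.invSelf x ^ i : Localization.Away x) :=
      .pow _ (IsUnit.of_mul_eq_one _
        ((mul_comm _ _).trans (IsLocalization.Away.mul_invSelf x)))
    rw [hu.smul_eq_zero, IsLocalizedModule.eq_zero_iff (Submonoid.powers x)] at h4
    obtain ⟨⟨_, N, rfl⟩, hN⟩ := h4
    change x ^ N • w = 0 at hN
    exact Subtype.ext (eq_zero_of_pow_smul_eq_zero (V := differentialsDegree 𝒜)
      (fun _ _ hv => smul_mem_differentialsDegree hx hv) hinj' (by omega) hw hN)
  · rw [← LinearMap.range_eq_top, LinearMap.range_domRestrict, eq_top_iff]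
    set V := (differentialsDegree 𝒜 i).map
      (((KaehlerDifferential.map K K A (Dehom x)).restrictScalars K).prod
        ((Ideal.Quotient.mkₐ K (Ideal.span {x - 1})).toLinearMap ∘ₗ
          (eulerContraction 𝒜).restrictScalars K))
    have hgen : ∀ (a b : ℕ) (f g : A), f ∈ 𝒜 a → g ∈ 𝒜 b → a + b = i →
        ((Ideal.Quotient.mk (Ideal.span {x - 1}) f • D K (Dehom x) (Ideal.Quotient.mk _ g),
          Ideal.Quotient.mk _ (b * (f * g))) : Ω[Dehom x⁄K] × Dehom x) ∈ V := by
      intro a b f g hf hg h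
      refine ⟨f • D K A g, Submodule.subset_span ⟨a, b, f, g, hf, hg, h, rfl⟩, ?_⟩
      refine Prod.ext ?_ ?_
      · change KaehlerDifferential.map K K A (Dehom x) (f • D K A g) = _
        rw [map_smul, KaehlerDifferential.map_D, ← algebraMap_smul (Dehom x) f]
        rfl
      · change Ideal.Quotient.mk _ (eulerContraction 𝒜 (f • D K A g)) = _
        rw [eulerContraction_smul_D f hg]
    -- The form `f dx` maps to `(0, f)`: `x` becomes `1`, so `dx` dies, and its degree is `1`, so
    -- the Euler coefficient is `1` in every characteristic. The `+ 1` in the bound on `i` leaves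
    -- room for this factor.
    have hright : ∀ s : Dehom x, ((0, s) : Ω[Dehom x⁄K] × Dehom x) ∈ V := by
      intro s
      obtain ⟨f, hf, rfl⟩ := exists_mem_mk_eq hx hk (i := i - 1) (by omega) s
      have := hgen (i - 1) 1 f x hf hx (by omega)
      simpa [mk_self] using this
    have hleft : ∀ w : Ω[Dehom x⁄K], ((w, 0) : Ω[Dehom x⁄K] × Dehom x) ∈ V := by
      intro w
      have hw : w ∈ Submodule.span (Dehom x) (Set.range (D K (Dehom x))) := by
        rw [KaehlerDifferential.span_range_derivation]; trivial
      -- `V` is only a `K`-subspace, so the span induction over `Dehom x` must carry all multiples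
      -- of `w`.
      suffices h : ∀ s : Dehom x, ((s • w, 0) : Ω[Dehom x⁄K] × Dehom x) ∈ V by
        simpa using h 1
      induction hw using Submodule.span_induction with
      | zero => exact fun s => by rw [smul_zero]; exact zero_mem V
      | add v w _ _ hv hw =>
        intro s
        have := add_mem (hv s) (hw s)
        rwa [Prod.mk_add_mk, add_zero, ← smul_add] at this
      | smul r w _ hw => exact fun s => by rw [smul_smul]; exact hw _
      | mem w hw =>
        obtain ⟨t, rfl⟩ := hw
        intro s
        -- Since `i ≥ 2k`, both degrees `i - k` and `k` are large enough to lift classes.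
        obtain ⟨f, hf, rfl⟩ := exists_mem_mk_eq hx hk (i := i - k) (by omega) s
        obtain ⟨g, hg, rfl⟩ := exists_mem_mk_eq hx hk (i := k) le_rfl t
        have := sub_mem (hgen (i - k) k f g hf hg (by omega))
          (hright (Ideal.Quotient.mk _ (k * (f * g))))
        rwa [Prod.mk_sub_mk, sub_zero, sub_self] at this
    rintro ⟨w, s⟩ -
    have := add_mem (hleft w) (hright s)
    simpa using this

end Dehomogenization

end ZeroDimScheme

/-! ### Vanishing of higher forms in the unramified case. -/

namespace ZeroDimScheme

universe u

section Dehomogenization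

variable {K A : Type u} [Field K] [CommRing A] [Algebra K A] {𝒜 : ℕ → Submodule K A}
  [GradedAlgebra 𝒜] {x : A} (hx : x ∈ 𝒜 1)

open KaehlerDifferential

include hx in
/-- If the dehomogenization at `x` is unramified, then every differential is a multiple of `dx`
after multiplication by a power of `x`. -/
theorem exists_pow_smul_D_eq [Subsingleton Ω[Dehom x⁄K]] {b : ℕ} {g : A} (hg : g ∈ 𝒜 b) :
    ∃ (N : ℕ) (c : A), x ^ N • D K A g = c • D K A x := by
  have hmem : D K A g ∈ differentialsDegree 𝒜 b :=
    Submodule.subset_span ⟨0, b, 1, g, SetLike.GradedOne.one_mem, hg, by simp, by simp⟩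
  have h := pow_smul_map_differential hx hmem
  have he : eulerContraction 𝒜 (D K A g) = b * g := by
    simpa using eulerContraction_smul_D 1 hg
  rw [Subsingleton.elim (KaehlerDifferential.map K K A (Dehom x) _) 0, map_zero, zero_add, he] at h
  -- Clearing denominators gives `x dg = b g dx` in the localization, hence in `Ω[A⁄K]` up to a
  -- power of `x`.
  have h2 := congrArg (fun z => algebraMap A (Localization.Away x) x ^ (b + 1) • z) h
  simp only [smul_smul, ← mul_assoc, ← mul_pow, IsLocalization.Away.mul_invSelf, one_pow,
    one_mul] at h2
  rw [pow_succ', mul_assoc, ← mul_pow, IsLocalization.Away.mul_invSelf, one_pow, mul_one,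
    algebraMap_smul, algebraMap_smul, ← KaehlerDifferential.map_D K K A, ← LinearMap.map_smul, ← LinearMap.map_smul,
    ← sub_eq_zero, ← map_sub, IsLocalizedModule.eq_zero_iff (Submonoid.powers x)] at h2
  obtain ⟨⟨_, N, rfl⟩, hN⟩ := h2
  change x ^ N • (x • D K A g - (b * g) • D K A x) = 0 at hN
  refine ⟨N + 1, x ^ N * (b * g), ?_⟩
  rwa [smul_sub, sub_eq_zero, smul_smul, smul_smul, ← pow_succ] at hN

include hx in
-- After scaling by powers of `x`, all factors are multiples of the single form `dx`, and `dx ∧ dx =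
-- 0`.
theorem exists_pow_smul_ιMulti_eq_zero [Subsingleton Ω[Dehom x⁄K]] {m : ℕ} (hm : 2 ≤ m)
    {b : Fin m → ℕ} {g : Fin m → A} (hg : ∀ j, g j ∈ 𝒜 (b j)) :
    ∃ N : ℕ, x ^ N • exteriorPower.ιMulti A m (fun j => D K A (g j)) = 0 := by
  choose N c h using fun j => exists_pow_smul_D_eq hx (hg j)
  refine ⟨∑ j, N j, ?_⟩
  have h1 := (exteriorPower.ιMulti A m).toMultilinearMap.map_smul_univ
    (fun j => x ^ N j) (fun j => D K A (g j))
  have h2 := (exteriorPower.ιMulti A m).toMultilinearMap.map_smul_univ c (fun _ => D K A x)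
  rw [← Finset.prod_pow_eq_pow_sum]
  simp only [AlternatingMap.coe_multilinearMap] at h1 h2
  rw [← h1]
  simp only [h]
  rw [h2, (exteriorPower.ιMulti A m).map_eq_zero_of_eq (fun _ => D K A x)
    (i := ⟨0, by omega⟩) (j := ⟨1, by omega⟩) rfl (by simp), smul_zero]

include hx in
theorem formsDegree_eq_bot [Subsingleton Ω[Dehom x⁄K]] {m k : ℕ} (hm : 2 ≤ m)
    (hinj : ∀ i, k ≤ i → ∀ w ∈ formsDegree 𝒜 m i, x • w = 0 → w = 0) {i : ℕ} (hi : k ≤ i) :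
    formsDegree 𝒜 m i = ⊥ := by
  rw [eq_bot_iff, formsDegree, Submodule.span_le]
  rintro _ ⟨a, b, f, g, hf, hg, h, rfl⟩
  obtain ⟨N, hN⟩ := exists_pow_smul_ιMulti_eq_zero hx hm hg
  refine eq_zero_of_pow_smul_eq_zero (N := N) (V := formsDegree 𝒜 m)
    (fun _ _ hv => smul_mem_formsDegree hx hv) hinj hi
    (Submodule.subset_span ⟨a, b, f, g, hf, hg, h, rfl⟩) ?_
  rw [smul_comm, hN, smul_zero]

end Dehomogenization

end ZeroDimScheme

/-! ### Divisibility by `x₀` and generators of the modules of forms. -/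

namespace ZeroDimScheme

universe u

/-- If no point of `Proj` lies on the hypersurface `x = 0`, then every homogeneous element of
positive degree has a power divisible by `x`. -/
theorem mem_radical_span_of_mem {K A : Type u} [CommRing K] [CommRing A] [Algebra K A]
    {𝒜 : ℕ → Submodule K A} [GradedAlgebra 𝒜] {x : A} {d : ℕ} (hxd : x ∈ 𝒜 d)
    (hx : ∀ p : ProjectiveSpectrum 𝒜, x ∉ p.asHomogeneousIdeal) {i : ℕ} (hi : i ≠ 0) {f : A}
    (hf : f ∈ 𝒜 i) : f ∈ (Ideal.span {x}).radical := by
  have hhom : (Ideal.span {x}).IsHomogeneous 𝒜 :=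
    Ideal.homogeneous_span 𝒜 _ (by rintro _ rfl; exact ⟨d, hxd⟩)
  rw [hhom.radical_eq]
  refine (Submodule.mem_sInf).mpr ?_
  rintro J ⟨hJ, hxJ, hprime⟩
  -- A homogeneous prime containing `x` but not `f` would not contain the irrelevant ideal, so it
  -- would be a point on `x = 0`.
  have hxJ : x ∈ J := hxJ (Ideal.mem_span_singleton_self x)
  by_contra hfJ
  refine hx ⟨⟨J, hJ⟩, hprime, fun hle => hfJ (hle ?_)⟩ hxJ
  exact HomogeneousIdeal.mem_irrelevant_of_mem 𝒜 (Nat.pos_of_ne_zero hi) hf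

section MonomialForms

variable {K A ι : Type*} [Field K] [CommRing A] [Algebra K A]

open KaehlerDifferential

variable (K) in
/-- The exterior monomial `dy_{r 0} ∧ ⋯ ∧ dy_{r (m - 1)}`. -/
noncomputable def monomialForm (y : ι → A) {m : ℕ} (r : Fin m → ι) : ⋀[A]^m Ω[A⁄K] :=
  exteriorPower.ιMulti A m fun j => D K A (y (r j))

end MonomialForms

section FormsDegree

variable {K A : Type u} {ι : Type*} [Field K] [CommRing A] [Algebra K A] {𝒜 : ℕ → Submodule K A}
  [GradedAlgebra 𝒜] {y : ι → A} [Fintype ι]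

open KaehlerDifferential

/-- Each `dg_j` expands in the `dy_l` with coefficients of degree one less, so `m` factors lower the
coefficient degree from `a + m` to `a`. Factors of degree zero, which cannot be lowered, have zero
differential. -/
theorem smul_ιMulti_mem_iSup [DecidableEq ι] (h0 : ∀ g ∈ 𝒜 0, D K A g = 0)
    (hD : ∀ b, ∀ g ∈ 𝒜 (b + 1),
      ∃ c : ι → A, (∀ l, c l ∈ 𝒜 b) ∧ D K A g = ∑ l, c l • D K A (y l))
    {m a a' : ℕ} {b : Fin m → ℕ} {f : A} {g : Fin m → A} (hf : f ∈ 𝒜 a') (hg : ∀ j, g j ∈ 𝒜 (b j))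
    (h : a' + ∑ j, b j = a + m) :
    f • exteriorPower.ιMulti A m (fun j => D K A (g j)) ∈ ⨆ r : Fin m → ι, (𝒜 a).map
      ((LinearMap.toSpanSingleton A _ (monomialForm K y r)).restrictScalars K) := by
  by_cases hb : ∃ j, b j = 0
  · obtain ⟨j, hj⟩ := hb
    rw [(exteriorPower.ιMulti A m).map_coord_zero j (h0 _ (hj ▸ hg j)), smul_zero]
    exact zero_mem _
  push Not at hb
  choose b' hb' using fun j => Nat.exists_eq_succ_of_ne_zero (hb j)
  obtain rfl : b = fun j => b' j + 1 := funext hb'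
  choose c hc hDc using fun j => hD _ _ (hg j)
  have h1 := (exteriorPower.ιMulti A m (M := Ω[A⁄K])).toMultilinearMap.map_sum
    (fun j l => c j l • D K A (y l))
  simp only [AlternatingMap.coe_multilinearMap] at h1
  rw [funext hDc, h1, Finset.smul_sum]
  refine Submodule.sum_mem _ fun r _ => ?_
  have h2 := (exteriorPower.ιMulti A m (M := Ω[A⁄K])).toMultilinearMap.map_smul_univ
    (fun j => c j (r j)) (fun j => D K A (y (r j)))
  simp only [AlternatingMap.coe_multilinearMap] at h2
  rw [h2, smul_smul]
  refine Submodule.mem_iSup_of_mem r ⟨_, ?_, rfl⟩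
  obtain rfl : a' + ∑ j, b' j = a := by
    simp only [Finset.sum_add_distrib, Finset.sum_const, Finset.card_univ, Fintype.card_fin,
      smul_eq_mul, mul_one] at h
    omega
  exact SetLike.mul_mem_graded hf (SetLike.prod_mem_graded 𝒜 _ _ fun j _ => hc j (r j))

/-- The forms of degree `a + m` are the combinations of the exterior monomials of length `m` with
coefficients of degree `a`. -/
theorem formsDegree_add_eq (hy : ∀ l, y l ∈ 𝒜 1) (h0 : ∀ g ∈ 𝒜 0, D K A g = 0)
    (hD : ∀ b, ∀ g ∈ 𝒜 (b + 1),
      ∃ c : ι → A, (∀ l, c l ∈ 𝒜 b) ∧ D K A g = ∑ l, c l • D K A (y l)) (m a : ℕ) :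
    formsDegree 𝒜 m (a + m) = ⨆ r : Fin m → ι, (𝒜 a).map
      ((LinearMap.toSpanSingleton A _ (monomialForm K y r)).restrictScalars K) := by
  classical
  apply le_antisymm
  · rw [formsDegree, Submodule.span_le]
    rintro _ ⟨a', b, f, g, hf, hg, h, rfl⟩
    exact smul_ιMulti_mem_iSup h0 hD hf hg h
  · refine iSup_le fun r => ?_
    rintro _ ⟨f, hf, rfl⟩
    exact Submodule.subset_span ⟨a, fun _ => 1, f, _, hf, fun j => hy (r j), by simp, rfl⟩

theorem finite_formsDegree_add [∀ i, Module.Finite K (𝒜 i)] (hy : ∀ l, y l ∈ 𝒜 1)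
    (h0 : ∀ g ∈ 𝒜 0, D K A g = 0)
    (hD : ∀ b, ∀ g ∈ 𝒜 (b + 1),
      ∃ c : ι → A, (∀ l, c l ∈ 𝒜 b) ∧ D K A g = ∑ l, c l • D K A (y l)) (m a : ℕ) :
    Module.Finite K (formsDegree 𝒜 m (a + m)) := by
  rw [formsDegree_add_eq hy h0 hD]
  infer_instance

/-- The exterior monomials do not depend on the degree, so surjectivity of `x` on coefficients
passes to forms. -/
theorem formsDegree_succ_eq_map (hy : ∀ l, y l ∈ 𝒜 1) (h0 : ∀ g ∈ 𝒜 0, D K A g = 0)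
    (hD : ∀ b, ∀ g ∈ 𝒜 (b + 1),
      ∃ c : ι → A, (∀ l, c l ∈ 𝒜 b) ∧ D K A g = ∑ l, c l • D K A (y l)) {x : A} {a : ℕ}
    (ha : 𝒜 (a + 1) = (𝒜 a).map (LinearMap.mulLeft K x)) (m : ℕ) :
    formsDegree 𝒜 m (a + 1 + m) =
      (formsDegree 𝒜 m (a + m)).map (Algebra.lsmul K K (⋀[A]^m Ω[A⁄K]) x) := by
  rw [formsDegree_add_eq hy h0 hD, formsDegree_add_eq hy h0 hD, Submodule.map_iSup]
  refine iSup_congr fun r => ?_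
  rw [ha, ← Submodule.map_comp, ← Submodule.map_comp]
  congr 1
  ext f
  exact mul_smul x f _

end FormsDegree

section CoordRing

variable {K : Type u} [Field K] {n : ℕ} (I : HomogeneousIdeal (stdGrading K n))

open KaehlerDifferential

instance finite_coordGrading (i : ℕ) : Module.Finite K (coordGrading I i) := by
  have : Module.Finite K (stdGrading K n i) :=
    Module.Finite.iff_fg.mpr (MvPolynomial.homogeneousSubmodule_fg _ _ i)
  exact Module.Finite.map (stdGrading K n i) _

theorem x₀_mem : x₀ I ∈ coordGrading I 1 :=
  mk_mem_quotientGrading _ _ (MvPolynomial.isHomogeneous_X K 0)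

/-- All variables lie in the radical of `x₀`, so some power of the ideal they generate lies in
`⟨x₀⟩`. -/
theorem exists_coordGrading_succ_eq_map
    (hx₀ : ∀ p : subscheme I, x₀ I ∉ p.asHomogeneousIdeal) :
    ∃ k, ∀ i, k ≤ i →
      coordGrading I (i + 1) = (coordGrading I i).map (LinearMap.mulLeft K (x₀ I)) := by
  have hle : MvPolynomial.idealOfVars (Fin (n + 1)) K ≤
      ((Ideal.span {x₀ I}).comap (Ideal.Quotient.mk I.toIdeal)).radical := by
    rw [← Ideal.comap_radical, MvPolynomial.idealOfVars, Ideal.span_le]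
    rintro _ ⟨j, rfl⟩
    exact mem_radical_span_of_mem (x₀_mem I) hx₀ one_ne_zero
      (mk_mem_quotientGrading _ _ (MvPolynomial.isHomogeneous_X K j))
  obtain ⟨k, hk⟩ := Ideal.exists_pow_le_of_le_radical_of_fg hle (MvPolynomial.idealOfVars_fg _ _)
  refine ⟨k, fun i hi => le_antisymm ?_ ?_⟩
  · rintro _ ⟨p, hp, rfl⟩
    have hp' : p ∈ MvPolynomial.idealOfVars (Fin (n + 1)) K ^ k := by
      rw [MvPolynomial.mem_pow_idealOfVars_iff']
      exact fun d hd => MvPolynomial.IsHomogeneous.coeff_eq_zero hp (by omega)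
    obtain ⟨g, hg⟩ := Ideal.mem_span_singleton.mp (hk hp')
    -- The cofactor `g` need not be homogeneous; its component of degree `i` does the job.
    refine ⟨DirectSum.decompose (coordGrading I) g i, SetLike.coe_mem _, ?_⟩
    have h1 := DirectSum.coe_decompose_mul_add_of_left_mem (coordGrading I) (j := i) (b := g)
      (x₀_mem I)
    rw [← hg, add_comm 1 i, DirectSum.decompose_of_mem_same _ (mk_mem_quotientGrading _ _ hp)] at h1
    exact h1.symm
  · rintro _ ⟨g, hg, rfl⟩
    rw [add_comm i 1]
    exact SetLike.mul_mem_graded (x₀_mem I) hg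

theorem D_mk_eq_sum (p : MvPolynomial (Fin (n + 1)) K) :
    D K (CoordRing I) (Ideal.Quotient.mk _ p) = ∑ j, Ideal.Quotient.mk I.toIdeal
      (MvPolynomial.pderiv j p) • D K (CoordRing I) (Ideal.Quotient.mk _ (MvPolynomial.X j)) := by
  have h := congrArg (KaehlerDifferential.map K K (MvPolynomial (Fin (n + 1)) K) (CoordRing I))
    ((mvPolynomialBasis K (Fin (n + 1))).sum_repr (D K _ p))
  rw [KaehlerDifferential.map_D, map_sum] at h
  refine h.symm.trans (Finset.sum_congr rfl fun j _ => ?_)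
  rw [map_smul, mvPolynomialBasis_repr_apply, mvPolynomialBasis_apply, KaehlerDifferential.map_D,
    ← algebraMap_smul (CoordRing I)]
  rfl

theorem D_eq_zero_of_mem_zero {g : CoordRing I} (hg : g ∈ coordGrading I 0) :
    D K (CoordRing I) g = 0 := by
  obtain ⟨p, hp, rfl⟩ := hg
  have hp : p.IsHomogeneous 0 := hp
  rw [← MvPolynomial.totalDegree_zero_iff_isHomogeneous,
    MvPolynomial.totalDegree_eq_zero_iff_eq_C] at hp
  rw [hp]
  exact Derivation.map_algebraMap _ _

theorem exists_D_eq_sum {b : ℕ} {g : CoordRing I} (hg : g ∈ coordGrading I (b + 1)) :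
    ∃ c : Fin (n + 1) → CoordRing I, (∀ l, c l ∈ coordGrading I b) ∧ D K (CoordRing I) g =
      ∑ l, c l • D K (CoordRing I) (Ideal.Quotient.mk _ (MvPolynomial.X l)) := by
  obtain ⟨p, hp, rfl⟩ := hg
  exact ⟨_, fun l => mk_mem_quotientGrading _ _ (MvPolynomial.IsHomogeneous.pderiv hp),
    D_mk_eq_sum I p⟩

end CoordRing

end ZeroDimScheme

/-! ### `Proj` as the spectrum of the dehomogenization. -/

namespace ZeroDimScheme

universe u

section ProjAffine

variable {K A : Type u} [Field K] [CommRing A] [Algebra K A] {𝒜 : ℕ → Submodule K A}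
  [GradedAlgebra 𝒜] {x : A}

/-- The map from the homogeneous localization at `x` to the dehomogenization at `x`. -/
noncomputable def awayToDehom (𝒜 : ℕ → Submodule K A) [GradedAlgebra 𝒜] (x : A) :
    HomogeneousLocalization.Away 𝒜 x →+* Dehom x :=
  (IsLocalization.Away.lift (S := Localization.Away x) x
    (g := Ideal.Quotient.mk (Ideal.span {x - 1})) (by rw [mk_self]; exact isUnit_one)).comp
    (algebraMap (HomogeneousLocalization.Away 𝒜 x) (Localization.Away x))

theorem awayToDehom_mk (hx : x ∈ 𝒜 1) (n : ℕ) {f : A} (hf : f ∈ 𝒜 (n • 1)) :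
    awayToDehom 𝒜 x (HomogeneousLocalization.Away.mk 𝒜 hx n f hf) =
      Ideal.Quotient.mk (Ideal.span {x - 1}) f := by
  rw [awayToDehom, RingHom.comp_apply, HomogeneousLocalization.algebraMap_apply,
    HomogeneousLocalization.Away.val_mk, Localization.mk_eq_mk']
  refine (IsLocalization.lift_mk'_spec _ _ _ _).mpr ?_
  simp [mk_self]

/-- The fraction `f / x^i` goes to the class of `f`. As `x` has degree `1`, every homogeneous `f` is
a numerator, and a vanishing class means that a power of `x` kills `f`. -/
theorem bijective_awayToDehom (hx : x ∈ 𝒜 1) : Function.Bijective (awayToDehom 𝒜 x) := by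
  constructor
  · rw [injective_iff_map_eq_zero]
    intro z hz
    obtain ⟨n, f, hf, rfl⟩ := HomogeneousLocalization.Away.mk_surjective 𝒜 hx z
    rw [awayToDehom_mk] at hz
    obtain ⟨N, hN⟩ := exists_pow_mul_eq_zero_of_mk_eq_zero hx hf hz
    apply HomogeneousLocalization.val_injective
    rw [HomogeneousLocalization.Away.val_mk, HomogeneousLocalization.val_zero,
      Localization.mk_eq_mk', IsLocalization.mk'_eq_zero_iff]
    exact ⟨⟨_, N, rfl⟩, hN⟩
  · rw [← RingHom.range_eq_top, eq_top_iff]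
    rintro s -
    obtain ⟨f, rfl⟩ := Ideal.Quotient.mk_surjective s
    induction f using DirectSum.Decomposition.inductionOn 𝒜 with
    | zero => exact zero_mem _
    | add a b ha hb => rw [map_add]; exact add_mem ha hb
    | @homogeneous i a =>
      exact ⟨HomogeneousLocalization.Away.mk 𝒜 hx i a (by simp), awayToDehom_mk hx i _⟩

theorem awayToDehom_comp_fromZeroRingHom :
    (awayToDehom 𝒜 x).comp ((HomogeneousLocalization.fromZeroRingHom 𝒜 _).comp
      (algebraMap K (𝒜 0))) = algebraMap K (Dehom x) := by
  ext c
  have : (HomogeneousLocalization.fromZeroRingHom 𝒜 (Submonoid.powers x)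
      (algebraMap K (𝒜 0) c)).val = algebraMap A (Localization.Away x) (algebraMap K A c) := by
    rw [← Localization.mk_one_eq_algebraMap]
    rfl
  simp only [awayToDehom, RingHom.comp_apply, HomogeneousLocalization.algebraMap_apply, this,
    IsLocalization.Away.lift_eq]
  rfl

/-- If no point of `Proj` lies on the hyperplane `x = 0`, then `Proj` is smooth if and only if the
dehomogenization at `x` is. -/
theorem smooth_projToSpec_iff (hx : x ∈ 𝒜 1)
    (hp : ∀ p : Proj 𝒜, x ∉ p.asHomogeneousIdeal) :
    Smooth (projToSpec K 𝒜) ↔ Algebra.Smooth K (Dehom x) := by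
  -- The chart `x ≠ 0` is all of `Proj`, so smoothness can be tested on one affine.
  have htop : (Proj.awayι 𝒜 x hx one_pos).opensRange = ⊤ := by
    rw [Proj.opensRange_awayι, eq_top_iff]
    exact fun p _ => hp p
  have := isIso_of_isOpenImmersion_of_opensRange_eq_top _ htop
  have : MorphismProperty.RespectsIso (C := Scheme.{u}) @Smooth :=
    smooth_isStableUnderBaseChange.respectsIso
  rw [← MorphismProperty.cancel_left_of_respectsIso (@Smooth.{u}) (Proj.awayι 𝒜 x hx one_pos),
    projToSpec, Proj.awayι_toSpecZero_assoc, ← Spec.map_comp, HasRingHomProperty.Spec_iff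
      (P := @Smooth), ← RingHom.smooth_algebraMap, ← awayToDehom_comp_fromZeroRingHom (𝒜 := 𝒜)]
  let e := RingEquiv.ofBijective _ (bijective_awayToDehom hx)
  constructor
  · intro h
    exact RingHom.Smooth.respectsIso.1 _ e h
  · intro h
    have he : e.symm.toRingHom.comp ((awayToDehom 𝒜 x).comp
        ((HomogeneousLocalization.fromZeroRingHom 𝒜 _).comp (algebraMap K (𝒜 0)))) =
        (HomogeneousLocalization.fromZeroRingHom 𝒜 _).comp (algebraMap K (𝒜 0)) :=
      RingHom.ext fun c => e.symm_apply_apply _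
    have hs : RingHom.Smooth (e.symm.toRingHom.comp ((awayToDehom 𝒜 x).comp
        ((HomogeneousLocalization.fromZeroRingHom 𝒜 _).comp (algebraMap K (𝒜 0))))) :=
      RingHom.Smooth.respectsIso.1 _ e.symm h
    rw [he] at hs
    exact hs

end ProjAffine

end ZeroDimScheme

/-! ### Hilbert polynomials and the equivalence. -/

namespace ZeroDimScheme

universe u

section HilbertPolynomial

variable {K : Type u} [Field K] {n : ℕ} (I : HomogeneousIdeal (stdGrading K n))

open KaehlerDifferential

/-- In large degrees the Hilbert function of `R` is constant and multiplication by `x₀` is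
injective on `R`. -/
theorem exists_forall_hilbertFun_eq (hx₀ : ∀ p : subscheme I, x₀ I ∉ p.asHomogeneousIdeal) :
    ∃ c i₀, ∀ i, i₀ ≤ i → hilbertFun (coordGrading I) i = c ∧
      ∀ f ∈ coordGrading I i, x₀ I * f = 0 → f = 0 := by
  obtain ⟨k, hk⟩ := exists_coordGrading_succ_eq_map I hx₀
  obtain ⟨i₀, h⟩ := Submodule.eventually_finrank_eq_of_map_eq (coordGrading I) _ hk
  exact ⟨_, i₀, h⟩

/-- In large degrees the Hilbert function of `Ω^m` is constant and multiplication by `x₀` is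
injective on `Ω^m`. -/
theorem exists_forall_hilbertFunForms_eq
    (hx₀ : ∀ p : subscheme I, x₀ I ∉ p.asHomogeneousIdeal) (m : ℕ) :
    ∃ c i₀, ∀ i, i₀ ≤ i → hilbertFunForms (coordGrading I) m i = c ∧
      ∀ w ∈ formsDegree (coordGrading I) m i, x₀ I • w = 0 → w = 0 := by
  obtain ⟨k, hk⟩ := exists_coordGrading_succ_eq_map I hx₀
  have hy : ∀ l, (Ideal.Quotient.mk I.toIdeal (MvPolynomial.X l)) ∈ coordGrading I 1 :=
    fun l => mk_mem_quotientGrading _ _ (MvPolynomial.isHomogeneous_X K l)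
  have : ∀ i, Module.Finite K (formsDegree (coordGrading I) m (i + m)) := fun i =>
    finite_formsDegree_add hy (fun g => D_eq_zero_of_mem_zero I)
      (fun b g => exists_D_eq_sum I) m i
  obtain ⟨i₀, h⟩ := Submodule.eventually_finrank_eq_of_map_eq
    (fun i => formsDegree (coordGrading I) m (i + m)) _ (k := k) fun i hi =>
      formsDegree_succ_eq_map hy (fun g => D_eq_zero_of_mem_zero I)
        (fun b g => exists_D_eq_sum I) (hk i hi) m
  refine ⟨hilbertFunForms (coordGrading I) m (i₀ + m), i₀ + m, fun i hi => ?_⟩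
  obtain ⟨j, rfl⟩ := Nat.exists_eq_add_of_le' (show m ≤ i by omega)
  exact h j (by omega)

theorem finite_affineCoordRing (hx₀ : ∀ p : subscheme I, x₀ I ∉ p.asHomogeneousIdeal) :
    Module.Finite K (AffineCoordRing I) ∧
      hilbertPoly (hilbertFun (coordGrading I)) = Module.finrank K (AffineCoordRing I) := by
  obtain ⟨k, hk⟩ := exists_coordGrading_succ_eq_map I hx₀
  obtain ⟨c, i₀, h⟩ := exists_forall_hilbertFun_eq I hx₀
  have hbij : ∀ i, k + i₀ ≤ i → _ := fun i hi =>
    bijective_mk_of_injective (x₀_mem I) (k := k + i₀) (fun i hi => hk i (by omega))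
      (fun i hi => (h i (by omega)).2) hi
  refine ⟨Module.Finite.of_surjective _ (hbij _ le_rfl).2, IsEventualValue.hilbertPoly_eq ?_⟩
  filter_upwards [Filter.eventually_ge_atTop (k + i₀)] with i hi
  exact (LinearEquiv.ofBijective _ (hbij i hi)).finrank_eq

/-- The summand `S` comes from the Euler contraction and contributes `deg X`; the excess measures
ramification. -/
theorem hilbertPoly_forms_one (hx₀ : ∀ p : subscheme I, x₀ I ∉ p.asHomogeneousIdeal) :
    Module.Finite K Ω[AffineCoordRing I⁄K] ∧ hilbertPoly (hilbertFunForms (coordGrading I) 1) =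
      Module.finrank K Ω[AffineCoordRing I⁄K] + Module.finrank K (AffineCoordRing I) := by
  obtain ⟨k, hk⟩ := exists_coordGrading_succ_eq_map I hx₀
  obtain ⟨c, i₀, h⟩ := exists_forall_hilbertFun_eq I hx₀
  obtain ⟨c', i₁, h'⟩ := exists_forall_hilbertFunForms_eq I hx₀ 1
  have := (finite_affineCoordRing I hx₀).1
  have hinj : ∀ i, k + i₀ + i₁ ≤ i → ∀ w ∈ differentialsDegree (coordGrading I) i,
      x₀ I • w = 0 → w = 0 := by
    intro i hi w hw hxw
    rw [← formsDegree_one_map] at hw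
    obtain ⟨v, hv, rfl⟩ := hw
    have hv0 : v = 0 := (h' i (by omega)).2 v hv
      ((exteriorPower.oneEquiv (CoordRing I) Ω[CoordRing I⁄K]).injective
        (by rw [map_smul, map_zero]; exact hxw))
    rw [hv0, map_zero]
  have hfin : Module.Finite K Ω[Dehom (x₀ I)⁄K] := KaehlerDifferential.finite_of_finite K _
  refine ⟨hfin, IsEventualValue.hilbertPoly_eq ?_⟩
  filter_upwards [Filter.eventually_ge_atTop
    ((k + i₀ + i₁) + (k + i₀ + i₁) + 1)] with i hi
  have hbij := bijective_map_prod_eulerContraction (x₀_mem I) (k := k + i₀ + i₁)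
    (fun i hi => hk i (by omega)) (fun i hi => (h i (by omega)).2) hinj hi
  rw [hilbertFunForms, finrank_formsDegree_one, (LinearEquiv.ofBijective _ hbij).finrank_eq,
    Module.finrank_prod]

/-- The scheme is smooth if and only if its affine coordinate ring is unramified. -/
theorem isSmoothSubscheme_iff (hx₀ : ∀ p : subscheme I, x₀ I ∉ p.asHomogeneousIdeal) :
    IsSmoothSubscheme I ↔ Subsingleton Ω[AffineCoordRing I⁄K] := by
  have := (finite_affineCoordRing I hx₀).1
  rw [← Algebra.smooth_iff_subsingleton_kaehlerDifferential]
  exact smooth_projToSpec_iff (x₀_mem I) hx₀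

theorem hilbertPoly_forms_eq_zero (hx₀ : ∀ p : subscheme I, x₀ I ∉ p.asHomogeneousIdeal)
    [Subsingleton Ω[AffineCoordRing I⁄K]] {m : ℕ} (hm : 2 ≤ m) :
    hilbertPoly (hilbertFunForms (coordGrading I) m) = 0 := by
  obtain ⟨c, i₀, h⟩ := exists_forall_hilbertFunForms_eq I hx₀ m
  apply IsEventualValue.hilbertPoly_eq
  filter_upwards [Filter.eventually_ge_atTop i₀] with i hi
  rw [hilbertFunForms, formsDegree_eq_bot (x₀_mem I) hm (fun i hi => (h i hi).2) hi, finrank_bot]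

end HilbertPolynomial

end ZeroDimScheme

theorem mainTheorem10 {K : Type*} [Field K] [PerfectField K] {n : ℕ}
    (I : HomogeneousIdeal (stdGrading K n))
    (hsat : IsSaturated I)
    (hdim : topologicalKrullDim (subscheme I) = 0)
    (hx₀ : ∀ p : subscheme I,
      x₀ I ∉ p.asHomogeneousIdeal) :
    ((∃ c, IsEventualValue
        (hilbertFun (coordGrading I)) c) ∧
      ∀ m : ℕ, ∃ c, IsEventualValue
        (hilbertFunForms (coordGrading I) m) c) ∧
    List.TFAE [
      IsSmoothSubscheme I,
      Subsingleton Ω[AffineCoordRing I⁄K],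
      hilbertPoly
          (hilbertFunForms (coordGrading I) 1) =
        hilbertPoly (hilbertFun (coordGrading I)) ∧
      ∀ m : ℕ, 2 ≤ m → hilbertPoly
        (hilbertFunForms (coordGrading I) m) = 0] := by
  obtain ⟨hfin, hone⟩ := hilbertPoly_forms_one I hx₀
  have hdeg := (finite_affineCoordRing I hx₀).2
  refine ⟨⟨?_, fun m => ?_⟩, ?_⟩
  · obtain ⟨c, i₀, h⟩ := exists_forall_hilbertFun_eq I hx₀
    exact ⟨c, Filter.eventually_atTop.mpr ⟨i₀, fun i hi => (h i hi).1⟩⟩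
  · obtain ⟨c, i₀, h⟩ := exists_forall_hilbertFunForms_eq I hx₀ m
    exact ⟨c, Filter.eventually_atTop.mpr ⟨i₀, fun i hi => (h i hi).1⟩⟩
  · tfae_have 1 ↔ 2 := isSmoothSubscheme_iff I hx₀
    tfae_have 2 → 3 := by
      intro h
      refine ⟨?_, fun m hm => hilbertPoly_forms_eq_zero I hx₀ hm⟩
      rw [hone, hdeg, Module.finrank_zero_of_subsingleton, zero_add]
    tfae_have 3 → 2 := by
      rintro ⟨h, -⟩
      rw [hone, hdeg] at h
      -- Finiteness of `Ω^1_S` matters: `finrank` is also `0` on infinite dimensional spaces.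
      exact (Module.finrank_zero_iff (R := K)).mp (by omega)
    tfae_finish
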